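/- Conventions. A school matching instance $I=(A,B,\succ,q)$ consists of finite sets $A$ of students and $B$ of schools, a strict total order $\succ_a$ on $B\cup\{\emptyset\}$ for each $a\in A$, a strict total order $\succ_b$ on $A\cup\{\emptyset\}$ for each $b\in B$ ($\emptyset$ is the outside option), and quotas $q_b\le |A|$. A matching assigns to each student a school or $\emptyset$, so that each school $b$ receives at most $q_b$ students; it is viewed as a set of pairs, where a school $b$ with fewer than $q_b$ students is also paired with $\emptyset$. It is stable if no student prefers $\emptyset$ to her school, no school prefers $\emptyset$ to one of its students, and there is no pair $(a,b)\in A\times B$ such that $a$ strictly prefers $b$ to her partner and $b$ strictly prefers $a$ to one of its partners. Let $\mathcal S(I)$ be the set of stable matchings, ordered by $M\ge M'$ iff every student weakly prefers $M$ to $M'$, and let $M_0$ be its largest element. A rotation is a pair $\rho(M,M')=(M\setminus M',M'\setminus M)$ with $M,M'\in\mathcal S(I)$, $M'<M$ and no stable matching strictly between; it is then said to be exposed in $M$. Let $\mathcal R(I)$ be the set of rotations. Write $M=M_0/R$ if $R$ is the set of rotations on a chain $M_0>M_1>\dots>M_k=M$ in which each $M_i$ is an immediate predecessor of $M_{i-1}$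 (the set $R$ depends only on $M$, and $M$ only on $R$; write $M=M_R$). For rotations put $\rho\trianglerighteq\rho'$ if $\rho=\rho'$ or if $\rho\in R$ whenever $\rho'$ is exposed in $M=M_0/R$. For $\mathcal F\subseteq\mathcal S(I)$, the problem of minimizing $f:\mathcal F\to\mathbb R$ over $\mathcal F$ is minimum cut representable if there are a digraph on the vertex set $\mathcal R(I)\cup\{s,t\}$ with arc capacities in $[0,\infty]$ and a constant $C\in\mathbb R$ such that (i) for each $R\subseteq\mathcal R(I)$, the $s$-$t$ cut $\{s\}\cup R$ has finite capacity if and only if $R$ is upper-closed for $\trianglerighteq$ and $M_R\in\mathcal F$, and (ii) each such finite cut has value $f(M_R)+C$. An instance of (MSSP) is a school matching instance $I$ (whose schools are called classes) with a set $\mathcal C\subseteq A\times A$ of pairs of distinct students (siblings) and a partition of $B$ into nonempty sets called activities, such that each student $a$ has, for each activity, exactly one class $b$ of that activity with $b\succ_a\emptyset$, and such that for every $(a,\bar a)\in\mathcal C$ and any two activities, $a$ prefers her class of the first to her class of the second if and only if $\bar a$ prefers his class of the first to his class of the second. Lemma. There exists an instance of (MSSP) for which no function $f:\mathcal S(I)\to\mathbb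 R$ has both of the following properties: the problem $\min\{f(M):M\in\mathcal S(I)\}$ is minimum cut representable; and for every pair $M,M'\in\mathcal S(I)$, $f(M)<f(M')$ if and only if $M$ matches strictly more pairs of siblings in $\mathcal C$ to classes of the same activity than $M'$ does. -/

import Mathlib

open scoped ENNReal

/-- A school matching instance `(A, B, ≻, q)` over finite sets of students `A` and schools `B`.
`none` is the outside option `∅`; `studentPref a x y` reads `x ≻_a y` (on `B ∪ {∅}`) and
`schoolPref b x y` reads `x ≻_b y` (on `A ∪ {∅}`). -/
structure SchoolInstance (A B : Type) where
  finite_students : Finite A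
  finite_schools : Finite B
  studentPref : A → Option B → Option B → Prop
  studentPref_strictTotal : ∀ a, IsStrictTotalOrder (Option B) (studentPref a)
  schoolPref : B → Option A → Option A → Prop
  schoolPref_strictTotal : ∀ b, IsStrictTotalOrder (Option A) (schoolPref b)
  quota : B → ℕ
  quota_le : ∀ b, quota b ≤ Nat.card A

namespace SchoolInstance

variable {A B : Type} (I : SchoolInstance A B)

/-- A matching: every student gets one school or the outside option, and no school exceeds its
quota. The associated set of pairs, which also records unfilled schools, is `Matching.pairs`. -/
@[ext]
structure Matching where
  partner : A → Option B
  card_le : ∀ b, {a | partner a = some b}.ncard ≤ I.quota b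

variable {I}

/-- The matching as a set of pairs in `(A ∪ {∅}) × (B ∪ {∅})`: each student with its partner, and
each school with fewer students than its quota with the outside option. -/
def Matching.pairs (M : I.Matching) : Set (Option A × Option B) :=
  {p | (∃ a, p = (some a, M.partner a)) ∨
    ∃ b, {a | M.partner a = some b}.ncard < I.quota b ∧ p = (none, some b)}

/-- The partners `M(b) ⊆ A ∪ {∅}` of a school `b`. -/
def Matching.schoolPartners (M : I.Matching) (b : B) : Set (Option A) :=
  {x | (x, some b) ∈ M.pairs}

/-- `ab` is a blocking pair. -/
def Matching.IsBlockingPair (M : I.Matching) (a : A) (b : B) : Prop :=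
  I.studentPref a (some b) (M.partner a) ∧
    ∃ x ∈ M.schoolPartners b, I.schoolPref b (some a) x

/-- Student `a` prefers the outside option to its assigned school. -/
def Matching.IsBlockingStudent (M : I.Matching) (a : A) : Prop :=
  I.studentPref a none (M.partner a)

/-- School `b` prefers the outside option to one of its assigned students. -/
def Matching.IsBlockingSchool (M : I.Matching) (b : B) : Prop :=
  ∃ a, M.partner a = some b ∧ I.schoolPref b none (some a)

/-- No blocking pairs and no blocking agents. -/
def Matching.IsStable (M : I.Matching) : Prop :=
  (∀ a b, ¬ M.IsBlockingPair a b) ∧ (∀ a, ¬ M.IsBlockingStudent a) ∧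
    ∀ b, ¬ M.IsBlockingSchool b

variable (I)

/-- The set `S(I)` of stable matchings, as a type. -/
def StableMatching : Type := {M : I.Matching // M.IsStable}

/-- `M' ≤ M` iff every student weakly prefers `M` to `M'`. -/
instance : PartialOrder I.StableMatching where
  le M' M := ∀ a, M.1.partner a = M'.1.partner a ∨
    I.studentPref a (M.1.partner a) (M'.1.partner a)
  le_refl _ _ := Or.inl rfl
  le_trans M₁ M₂ M₃ h₁ h₂ a := by
    have := I.studentPref_strictTotal a
    rcases h₁ a with e | e
    · rw [← e]; exact h₂ a
    · rcases h₂ a with e' | e'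
      · rw [e']; exact Or.inr e
      · exact Or.inr (_root_.trans e' e)
  le_antisymm M₁ M₂ h₁ h₂ := by
    apply Subtype.ext
    apply Matching.ext
    funext a
    have := I.studentPref_strictTotal a
    rcases h₁ a with e | e
    · exact e.symm
    · rcases h₂ a with e' | e'
      · exact e'
      · exact absurd e' (asymm_of (I.studentPref a) e)

variable {I}

/-- The pair `ρ(M, M') = (M \ M', M' \ M)`. -/
def rotationPair (M M' : I.StableMatching) :
    Set (Option A × Option B) × Set (Option A × Option B) :=
  (M.1.pairs \ M'.1.pairs, M'.1.pairs \ M.1.pairs)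

variable (I)

/-- The rotations `R(I)`: the pairs `ρ(M, M')` with `M'` an immediate predecessor of `M`,
that is, `M' < M` with no stable matching strictly between (written `M' ⋖ M`). -/
def Rotation : Type :=
  {ρ : Set (Option A × Option B) × Set (Option A × Option B) //
    ∃ M M' : I.StableMatching, M' ⋖ M ∧ ρ = rotationPair M M'}

variable {I}

/-- The rotation `ρ(M, M')`. -/
def rotation (M M' : I.StableMatching) (h : M' ⋖ M) : I.Rotation :=
  ⟨rotationPair M M', M, M', h, rfl⟩

/-- `ρ` is exposed in `M`. -/
def Rotation.IsExposed (ρ : I.Rotation) (M : I.StableMatching) : Prop :=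
  ∃ (M' : I.StableMatching) (h : M' ⋖ M), ρ = rotation M M' h

/-- `IsElimination M R` says `M = M₀ / R`: there is a chain of immediate predecessors from the
student-optimal stable matching `M₀` to `M` whose set of rotations is `R`. -/
inductive IsElimination : I.StableMatching → Set I.Rotation → Prop
  | optimal (M₀ : I.StableMatching) (h : ∀ M, M ≤ M₀) : IsElimination M₀ ∅
  | step (M M' : I.StableMatching) (R : Set I.Rotation) (h : M' ⋖ M) :
      IsElimination M R → IsElimination M' (insert (rotation M M' h) R)

/-- The order `ρ ⊵ ρ'` of the poset of rotations: `ρ = ρ'`, or `ρ` is eliminated before any stable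
matching in which `ρ'` is exposed. -/
def Rotation.Above (ρ ρ' : I.Rotation) : Prop :=
  ρ = ρ' ∨ ∀ (M : I.StableMatching) (R : Set I.Rotation),
    ρ'.IsExposed M → IsElimination M R → ρ ∈ R

/-- Upper-closed sets of rotations. -/
def IsUpperClosed (R : Set I.Rotation) : Prop :=
  ∀ ρ' ∈ R, ∀ ρ : I.Rotation, ρ.Above ρ' → ρ ∈ R

variable (I)

/-- The vertices `R(I) ∪ {s, t}` of a witness digraph. -/
inductive CutVertex where
  | source : CutVertex
  | sink : CutVertex
  | rot (ρ : I.Rotation) : CutVertex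

variable {I}

/-- The vertex set `{s} ∪ R`. -/
def cutSet (R : Set I.Rotation) : Set I.CutVertex :=
  {CutVertex.source} ∪ CutVertex.rot '' R

end SchoolInstance

open Classical in
/-- The value of the cut `X` in a digraph with arc capacities in `[0, ∞]`: the total capacity of
the arcs that leave `X`. -/
noncomputable def cutValue {V : Type} (D : Digraph V) (cap : V → V → ℝ≥0∞) (X : Set V) : ℝ≥0∞ :=
  ∑' (u : V) (v : V), if D.Adj u v ∧ u ∈ X ∧ v ∉ X then cap u v else 0

namespace SchoolInstance

/-- The problem `min {f(M) : M ∈ F}` is minimum cut representable. -/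
def MinCutRepresentable {A B : Type} (I : SchoolInstance A B) (F : Set I.StableMatching)
    (f : F → ℝ) : Prop :=
  ∃ (D : Digraph I.CutVertex) (cap : I.CutVertex → I.CutVertex → ℝ≥0∞) (C : ℝ),
    (∀ R : Set I.Rotation, cutValue D cap (cutSet R) < ∞ ↔
      IsUpperClosed R ∧ ∃ M ∈ F, IsElimination M R) ∧
    (∀ R : Set I.Rotation, cutValue D cap (cutSet R) < ∞ →
      ∀ M : F, IsElimination M.1 R → (cutValue D cap (cutSet R)).toReal = f M + C)

end SchoolInstance

/-- An instance of (MSSP): a school matching instance with a set of pairs of siblings and a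
partition of the schools (called classes) into the activities `Q`. -/
structure MSSPInstance (A B Q : Type) extends SchoolInstance A B where
  siblings : Finset (A × A)
  siblings_ne : ∀ p ∈ siblings, p.1 ≠ p.2
  /-- the activity of a class -/
  activity : B → Q
  /-- every activity has a class -/
  activity_surjective : Function.Surjective activity
  /-- every student is eligible for exactly one class of each activity -/
  eligible_unique : ∀ (a : A) (j : Q), ∃! b : B, activity b = j ∧ studentPref a (some b) none
  /-- siblings rank the activities in the same order -/
  same_order : ∀ p ∈ siblings, ∀ b₁ b₂ c₁ c₂ : B,
    activity b₁ = activity c₁ → activity b₂ = activity c₂ →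
    studentPref p.1 (some b₁) none → studentPref p.1 (some b₂) none →
    studentPref p.2 (some c₁) none → studentPref p.2 (some c₂) none →
    (studentPref p.1 (some b₁) (some b₂) ↔ studentPref p.2 (some c₁) (some c₂))

namespace MSSPInstance

variable {A B Q : Type} (J : MSSPInstance A B Q)

/-- `M` matches `a` and `a'` to classes of the same activity. -/
def SameActivity (M : J.toSchoolInstance.StableMatching) (a a' : A) : Prop :=
  ∃ b b' : B, M.1.partner a = some b ∧ M.1.partner a' = some b' ∧ J.activity b = J.activity b'

open Classical in
/-- The number of sibling pairs that `M` matches to the same activity. -/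
noncomputable def numSameActivity (M : J.toSchoolInstance.StableMatching) : ℕ :=
  (J.siblings.filter fun p => J.SameActivity M p.1 p.2).card

end MSSPInstance

/-- Cut values are submodular. -/
theorem cutValue_inter_add_union_le {V : Type} (D : Digraph V) (cap : V → V → ℝ≥0∞)
    (X Y : Set V) :
    cutValue D cap (X ∩ Y) + cutValue D cap (X ∪ Y) ≤ cutValue D cap X + cutValue D cap Y := by
  classical
  unfold cutValue
  simp only [← ENNReal.tsum_add]
  refine ENNReal.tsum_le_tsum fun u => ENNReal.tsum_le_tsum fun v => ?_
  by_cases hA : D.Adj u v <;> by_cases h1 : u ∈ X <;> by_cases h2 : u ∈ Y <;>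
    by_cases h3 : v ∈ X <;> by_cases h4 : v ∈ Y <;> simp [hA, h1, h2, h3, h4]

namespace SchoolInstance

variable {A B : Type} {I : SchoolInstance A B}

/-- The set of rotations eliminated on the way to a stable matching is upper-closed. -/
theorem IsElimination.isUpperClosed {M : I.StableMatching} {R : Set I.Rotation}
    (h : IsElimination M R) : IsUpperClosed R := by
  induction h with
  | optimal => exact fun _ h => h.elim
  | step M M' R hc hR ih =>
    rintro ρ' (rfl | hρ') ρ hρ
    · rcases hρ with rfl | hρ
      · exact Set.mem_insert _ _
      · exact Set.mem_insert_of_mem _ (hρ M R ⟨M', hc, rfl⟩ hR)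
    · exact Set.mem_insert_of_mem _ (ih ρ' hρ' ρ hρ)

theorem cutSet_inter (R S : Set I.Rotation) : cutSet R ∩ cutSet S = cutSet (R ∩ S) := by
  ext v
  cases v <;> simp [cutSet]

theorem cutSet_union (R S : Set I.Rotation) : cutSet R ∪ cutSet S = cutSet (R ∪ S) := by
  ext v
  cases v <;> simp [cutSet]

/-- A minimum cut representable objective is submodular in the eliminated sets of rotations. -/
theorem MinCutRepresentable.submodular {f : I.StableMatching → ℝ}
    (h : I.MinCutRepresentable Set.univ fun M => f M.1)
    {M N K L : I.StableMatching} {R S : Set I.Rotation} (hM : IsElimination M R)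
    (hN : IsElimination N S) (hK : IsElimination K (R ∩ S)) (hL : IsElimination L (R ∪ S)) :
    f K + f L ≤ f M + f N := by
  obtain ⟨D, cap, C, hfin, hval⟩ := h
  have fin {P : I.StableMatching} {T : Set I.Rotation} (hP : IsElimination P T) :
      cutValue D cap (cutSet T) < ∞ :=
    (hfin T).2 ⟨hP.isUpperClosed, P, Set.mem_univ _, hP⟩
  have val {P : I.StableMatching} {T : Set I.Rotation} (hP : IsElimination P T) :
      (cutValue D cap (cutSet T)).toReal = f P + C :=
    hval T (fin hP) ⟨P, Set.mem_univ _⟩ hP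
  have key := cutValue_inter_add_union_le D cap (cutSet R) (cutSet S)
  rw [cutSet_inter, cutSet_union] at key
  have := ENNReal.toReal_mono (ENNReal.add_ne_top.2 ⟨(fin hM).ne, (fin hN).ne⟩) key
  rw [ENNReal.toReal_add (fin hK).ne (fin hL).ne, ENNReal.toReal_add (fin hM).ne (fin hN).ne,
    val hM, val hN, val hK, val hL] at this
  linarith

end SchoolInstance

namespace SiblingExample

open SchoolInstance

/-- Positions in the preference list of a student. -/
def studentRank (a : Fin 4) : Option (Fin 4) → ℕ
  | none => 3
  | some b => (![![0, 1, 4, 2], ![1, 0, 4, 2], ![0, 4, 1, 2], ![2, 4, 1, 0]] :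
      Fin 4 → Fin 4 → ℕ) a b

/-- Positions in the preference list of a class. -/
def classRank (b : Fin 4) : Option (Fin 4) → ℕ
  | none => 4
  | some a => (![![1, 0, 2, 3], ![0, 1, 2, 3], ![2, 3, 1, 0], ![2, 3, 0, 1]] :
      Fin 4 → Fin 4 → ℕ) b a

theorem isStrictTotalOrder_rank {α : Type} {r : α → ℕ} (hr : Function.Injective r) :
    IsStrictTotalOrder α fun x y => r x < r y where
  irrefl _ := lt_irrefl _
  trans _ _ _ := lt_trans
  trichotomous _ _ h h' := hr (le_antisymm (not_lt.1 h') (not_lt.1 h))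

/-- Four students and four classes of quota one, in three activities: classes `1` and `2` belong
to the same activity, and students `0` and `2` are siblings. -/
def inst : MSSPInstance (Fin 4) (Fin 4) (Fin 3) where
  finite_students := inferInstance
  finite_schools := inferInstance
  studentPref a x y := studentRank a x < studentRank a y
  studentPref_strictTotal a := isStrictTotalOrder_rank (by
    revert a; unfold Function.Injective; decide)
  schoolPref b x y := classRank b x < classRank b y
  schoolPref_strictTotal b := isStrictTotalOrder_rank (by
    revert b; unfold Function.Injective; decide)
  quota _ := 1
  quota_le _ := by simp
  siblings := {(0, 2)}
  siblings_ne := by decide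
  activity := ![0, 1, 1, 2]
  activity_surjective := by unfold Function.Surjective; decide
  eligible_unique := by unfold ExistsUnique; decide
  same_order := by
    simp only [Finset.mem_singleton, forall_eq]
    decide

/-- The two rotations are independent: `i` tells whether students `0` and `1` have swapped, `j`
whether students `2` and `3` have. -/
def assignment (i j : Bool) : Fin 4 → Fin 4 :=
  ![bif i then 1 else 0, bif i then 0 else 1, bif j then 3 else 2, bif j then 2 else 3]

theorem setOf_assignment_ncard (i j : Bool) (b : Fin 4) :
    {a | some (assignment i j a) = some b}.ncard = 1 := by
  have h : ∀ (i j : Bool) (b : Fin 4), ∃ a, ∀ x, some (assignment i j x) = some b ↔ x = a := by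
    decide
  obtain ⟨a, ha⟩ := h i j b
  exact Set.ncard_eq_one.2 ⟨a, Set.ext ha⟩

/-- The matching given by `assignment`. -/
def matching (i j : Bool) : inst.Matching where
  partner a := some (assignment i j a)
  card_le b := (setOf_assignment_ncard i j b).le

theorem mem_pairs_matching (i j : Bool) (p : Option (Fin 4) × Option (Fin 4)) :
    p ∈ (matching i j).pairs ↔ ∃ a, p = (some a, some (assignment i j a)) := by
  refine ⟨?_, Or.inl⟩
  rintro (h | ⟨b, h, -⟩)
  · exact h
  · exact absurd (setOf_assignment_ncard i j b) (ne_of_lt h)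

theorem isStable_matching (i j : Bool) : (matching i j).IsStable := by
  refine ⟨?_, ?_, ?_⟩
  · rintro a b ⟨h₁, x, hx, h₂⟩
    obtain ⟨c, hc⟩ := (mem_pairs_matching i j _).1 hx
    obtain ⟨rfl, hc⟩ := Prod.ext_iff.1 hc
    have key : ∀ (i j : Bool) (a b c : Fin 4), some b = some (assignment i j c) →
        studentRank a (some b) < studentRank a (some (assignment i j a)) →
        ¬ classRank b (some a) < classRank b (some c) := by decide
    exact key i j a b c hc h₁ h₂
  · have key : ∀ (i j : Bool) (a : Fin 4),
        ¬ studentRank a none < studentRank a (some (assignment i j a)) := by decide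
    exact key i j
  · rintro b ⟨a, -, h⟩
    have key : ∀ a b : Fin 4, ¬ classRank b none < classRank b (some a) := by decide
    exact key a b h

/-- The stable matching given by `assignment`. -/
def stable (i j : Bool) : inst.toSchoolInstance.StableMatching :=
  ⟨matching i j, isStable_matching i j⟩

theorem partner_injOn (M : inst.Matching) {a a' b : Fin 4} (h : M.partner a = some b)
    (h' : M.partner a' = some b) : a = a' :=
  (Set.ncard_le_one (Set.toFinite _)).1 (M.card_le b) a h a' h'

/-- In a stable matching, a student does not end up below a class whose favourite it is. -/
theorem not_pref_of_favourite (M : inst.toSchoolInstance.StableMatching) (a b : Fin 4)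
    (hfav : ∀ x, x ≠ some a → classRank b (some a) < classRank b x) :
    studentRank a (M.1.partner a) ≤ studentRank a (some b) := by
  by_contra! h
  have hne : ∀ c, M.1.partner c = some b → c ≠ a := by
    rintro c hc rfl
    rw [hc] at h
    exact lt_irrefl _ h
  refine M.2.1 a b ⟨h, ?_⟩
  by_cases hb : ∃ c, M.1.partner c = some b
  · obtain ⟨c, hc⟩ := hb
    exact ⟨some c, Or.inl ⟨c, by rw [hc]⟩, hfav _ fun e => hne c hc (Option.some.inj e)⟩
  · push Not at hb
    refine ⟨none, Or.inr ⟨b, ?_, rfl⟩, hfav _ (by simp)⟩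
    have : {a | M.1.partner a = some b} = ∅ := Set.eq_empty_of_forall_notMem hb
    rw [this, Set.ncard_empty]
    exact Nat.one_pos

theorem exists_eq_stable (M : inst.toSchoolInstance.StableMatching) :
    ∃ i j, M = stable i j := by
  have h0 := not_pref_of_favourite M 0 1 (by decide)
  have h1 := not_pref_of_favourite M 1 0 (by decide)
  have h2 := not_pref_of_favourite M 2 3 (by decide)
  have h3 := not_pref_of_favourite M 3 2 (by decide)
  have k0 : ∀ x, studentRank 0 x ≤ studentRank 0 (some 1) → x = some 0 ∨ x = some 1 := by decide
  have k1 : ∀ x, studentRank 1 x ≤ studentRank 1 (some 0) → x = some 0 ∨ x = some 1 := by decide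
  have k2 : ∀ x, studentRank 2 x ≤ studentRank 2 (some 3) →
      x = some 0 ∨ x = some 2 ∨ x = some 3 := by decide
  have k3 : ∀ x, studentRank 3 x ≤ studentRank 3 (some 2) → x = some 2 ∨ x = some 3 := by decide
  have inj := @partner_injOn M.1
  have h01 (b) (e : M.1.partner 0 = some b) (e' : M.1.partner 1 = some b) : False :=
    absurd (inj e e') (by decide)
  have h02 (b) (e : M.1.partner 0 = some b) (e' : M.1.partner 2 = some b) : False :=
    absurd (inj e e') (by decide)
  have h12 (b) (e : M.1.partner 1 = some b) (e' : M.1.partner 2 = some b) : False :=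
    absurd (inj e e') (by decide)
  have h23 (b) (e : M.1.partner 2 = some b) (e' : M.1.partner 3 = some b) : False :=
    absurd (inj e e') (by decide)
  have fin (i j : Bool) (e0 : M.1.partner 0 = some (assignment i j 0))
      (e1 : M.1.partner 1 = some (assignment i j 1))
      (e2 : M.1.partner 2 = some (assignment i j 2))
      (e3 : M.1.partner 3 = some (assignment i j 3)) : ∃ i j, M = stable i j := by
    refine ⟨i, j, Subtype.ext (Matching.ext (funext fun a => ?_))⟩
    fin_cases a <;> assumption
  rcases k0 _ h0 with e0 | e0 <;> rcases k1 _ h1 with e1 | e1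
  · exact (h01 _ e0 e1).elim
  · rcases k2 _ h2 with e2 | e2 | e2
    · exact (h02 _ e0 e2).elim
    · rcases k3 _ h3 with e3 | e3
      · exact (h23 _ e2 e3).elim
      · exact fin false false e0 e1 e2 e3
    · rcases k3 _ h3 with e3 | e3
      · exact fin false true e0 e1 e2 e3
      · exact (h23 _ e2 e3).elim
  · rcases k2 _ h2 with e2 | e2 | e2
    · exact (h12 _ e1 e2).elim
    · rcases k3 _ h3 with e3 | e3
      · exact (h23 _ e2 e3).elim
      · exact fin true false e0 e1 e2 e3
    · rcases k3 _ h3 with e3 | e3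
      · exact fin true true e0 e1 e2 e3
      · exact (h23 _ e2 e3).elim
  · exact (h01 _ e0 e1).elim

theorem stable_le_stable {i j i' j' : Bool} :
    stable i j ≤ stable i' j' ↔ i' ≤ i ∧ j' ≤ j := by
  have key : ∀ i j i' j' : Bool,
      (∀ a, some (assignment i' j' a) = some (assignment i j a) ∨
        studentRank a (some (assignment i' j' a)) < studentRank a (some (assignment i j a))) ↔
      i' ≤ i ∧ j' ≤ j := by decide
  exact key i j i' j'

theorem stable_covBy_left (j : Bool) : stable true j ⋖ stable false j := by
  refine ⟨?_, fun K h₁ h₂ => ?_⟩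
  · rw [lt_iff_le_not_ge, stable_le_stable, stable_le_stable]
    revert j; decide
  · obtain ⟨i', j', rfl⟩ := exists_eq_stable K
    rw [lt_iff_le_not_ge, stable_le_stable, stable_le_stable] at h₁ h₂
    revert j i' j'; decide

theorem stable_covBy_right (i : Bool) : stable i true ⋖ stable i false := by
  refine ⟨?_, fun K h₁ h₂ => ?_⟩
  · rw [lt_iff_le_not_ge, stable_le_stable, stable_le_stable]
    revert i; decide
  · obtain ⟨i', j', rfl⟩ := exists_eq_stable K
    rw [lt_iff_le_not_ge, stable_le_stable, stable_le_stable] at h₁ h₂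
    revert i i' j'; decide

/-- The rotation of students `0` and `1`. -/
def leftRotation : inst.toSchoolInstance.Rotation :=
  rotation _ _ (stable_covBy_left false)

/-- The rotation of students `2` and `3`. -/
def rightRotation : inst.toSchoolInstance.Rotation :=
  rotation _ _ (stable_covBy_right false)

theorem rotation_right_eq :
    rotation _ _ (stable_covBy_right true) = rightRotation := by
  apply Subtype.ext
  change (_, _) = (_, _)
  congr 1 <;> ext p <;> simp only [stable, Set.mem_sdiff, mem_pairs_matching] <;>
    revert p <;> decide

theorem leftRotation_ne_rightRotation : leftRotation ≠ rightRotation := by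
  intro h
  have h' : ((some 0, some 0) : Option (Fin 4) × Option (Fin 4)) ∈ rightRotation.1.1 := by
    rw [← h]
    change _ ∈ (matching false false).pairs \ (matching true false).pairs
    simp only [Set.mem_sdiff, mem_pairs_matching]
    decide
  change _ ∈ (matching false false).pairs \ (matching false true).pairs at h'
  simp only [Set.mem_sdiff, mem_pairs_matching] at h'
  revert h'
  decide

theorem isElimination_optimal : IsElimination (stable false false) ∅ := by
  refine .optimal _ fun M => ?_
  obtain ⟨i, j, rfl⟩ := exists_eq_stable M
  exact stable_le_stable.2 ⟨Bool.false_le i, Bool.false_le j⟩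

theorem isElimination_left : IsElimination (stable true false) {leftRotation} := by
  have := isElimination_optimal.step _ _ _ (stable_covBy_left false)
  rwa [insert_empty_eq] at this

theorem isElimination_right : IsElimination (stable false true) {rightRotation} := by
  have := isElimination_optimal.step _ _ _ (stable_covBy_right false)
  rwa [insert_empty_eq] at this

theorem isElimination_both :
    IsElimination (stable true true) {rightRotation, leftRotation} := by
  have := isElimination_left.step _ _ _ (stable_covBy_right true)
  rwa [rotation_right_eq] at this

/-- The siblings attend the same activity only after the left rotation alone. -/
theorem numSameActivity_stable (i j : Bool) :
    inst.numSameActivity (stable i j) = if i = true ∧ j = false then 1 else 0 := by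
  classical
  have h : inst.SameActivity (stable i j) 0 2 ↔ i = true ∧ j = false := by
    have key : ∀ i j : Bool, (∃ b b' : Fin 4, some (assignment i j 0) = some b ∧
        some (assignment i j 2) = some b' ∧
        (![0, 1, 1, 2] : Fin 4 → Fin 3) b = (![0, 1, 1, 2] : Fin 4 → Fin 3) b') ↔
        i = true ∧ j = false := by decide
    exact key i j
  change (Finset.filter _ ({(0, 2)} : Finset (Fin 4 × Fin 4))).card = _
  rw [Finset.filter_singleton]
  by_cases hij : i = true ∧ j = false
  · rw [if_pos (h.2 hij), if_pos hij, Finset.card_singleton]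
  · rw [if_neg (mt h.1 hij), if_neg hij, Finset.card_empty]

end SiblingExample

open SchoolInstance SiblingExample in
theorem mainTheorem12 :
    ∃ (A B Q : Type) (J : MSSPInstance A B Q),
      ¬ ∃ f : J.toSchoolInstance.StableMatching → ℝ,
        J.toSchoolInstance.MinCutRepresentable Set.univ (fun M => f M.1) ∧
        ∀ M M' : J.toSchoolInstance.StableMatching,
          f M < f M' ↔ J.numSameActivity M' < J.numSameActivity M := by
  refine ⟨Fin 4, Fin 4, Fin 3, inst, ?_⟩
  rintro ⟨f, hf, hlt⟩
  have hsub := hf.submodular (K := stable false false) (L := stable true true)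
    isElimination_left isElimination_right
    (by rw [Set.singleton_inter_eq_empty.2
          (by simpa using leftRotation_ne_rightRotation)]
        exact isElimination_optimal)
    (by rw [Set.union_comm]; exact isElimination_both)
  have h₁ : f (stable true false) < f (stable false false) := by
    rw [hlt, numSameActivity_stable, numSameActivity_stable]; decide
  have h₂ : ¬ f (stable true true) < f (stable false true) := by
    rw [hlt, numSameActivity_stable, numSameActivity_stable]; decide
  linarith
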